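/- Let $K$ be an infinite field and $S=K[x_1,\dots,x_n]$ the standard graded polynomial ring. For a homogeneous ideal $M\subset S$ let $H(M,d)=\dim_K M_d$. An invertible matrix $g=(a_{ij})\in \mathrm{GL}_n(K)$ acts on $S$ as the $K$-algebra automorphism with $g(x_i)=\sum_{j=1}^n a_{ji}x_j$ for all $i$; a property holds for a general $g$ if it holds for all $g$ in some non-empty Zariski open subset of $\mathrm{GL}_n(K)$. For a term order $>_\sigma$ and a homogeneous ideal $I$, let $\mathrm{Gin}_\sigma(I)$ be the generic initial ideal of $I$, that is, the ideal equal to $\mathrm{in}_\sigma(g(I))$ for a general $g\in\mathrm{GL}_n(K)$. Let $>_{\mathrm{lex}}$ be the lexicographic order induced by $x_1>\cdots>x_n$ and $>_{\mathrm{oplex}}$ the lexicographic order induced by $x_n>\cdots>x_1$. Let $I,J\subset S$ be homogeneous ideals. Then for a general $g\in\mathrm{GL}_n(K)$: (i) $H(I\cap g(J),d)\le H(\mathrm{Gin}_{\mathrm{lex}}(I)\cap \mathrm{Gin}_{\mathrm{oplex}}(J),d)$ for all $d\ge 0$; (ii) $H(I\,g(J),d)\ge H(\mathrm{Gin}_{\mathrm{lex}}(I)\,\mathrm{Gin}_{\mathrm{oplex}}(J),d)$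 for all $d\ge 0$. -/

import Mathlib

open MvPolynomial

noncomputable section

namespace GeneralIntersections

attribute [local instance] MvPolynomial.gradedAlgebra

/-- A homogeneous ideal of the standard graded polynomial ring `S = K[x_1, …, x_n]`. The variables
are indexed by `Fin n`, so that `x_1, …, x_n` are `X 0, …, X (n - 1)`. -/
def IsHomogeneousIdeal {K : Type*} [Field K] {n : ℕ} (I : Ideal (MvPolynomial (Fin n) K)) : Prop :=
  I.IsHomogeneous (homogeneousSubmodule (Fin n) K)

/-- The `K`-vector space `I_d`: the elements of `I` that are homogeneous of degree `d`. -/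
def degreePart {K : Type*} [Field K] {n : ℕ} (I : Ideal (MvPolynomial (Fin n) K)) (d : ℕ) :
    Submodule K (MvPolynomial (Fin n) K) :=
  I.restrictScalars K ⊓ homogeneousSubmodule (Fin n) K d

/-- The Hilbert function `H(I, d) = dim_K I_d` of a homogeneous ideal `I`, as a graded module. -/
def hilbert {K : Type*} [Field K] {n : ℕ} (I : Ideal (MvPolynomial (Fin n) K)) (d : ℕ) : ℕ :=
  Module.finrank K (degreePart I d)

/-- The change of coordinates defined by `g = (a_ij) ∈ GL_n(K)`: the `K`-algebra endomorphism of `S`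
with `g(x_i) = ∑_j a_ji x_j`. -/
def changeCoord {K : Type*} [Field K] {n : ℕ} (g : GL (Fin n) K) :
    MvPolynomial (Fin n) K →ₐ[K] MvPolynomial (Fin n) K :=
  aeval fun i => ∑ j, C (g.val j i) * X j

/-- The ideal `g(I)`. Since `changeCoord g` is an automorphism, the ideal generated by the image of
`I` is the image itself. -/
def actIdeal {K : Type*} [Field K] {n : ℕ} (g : GL (Fin n) K)
    (I : Ideal (MvPolynomial (Fin n) K)) : Ideal (MvPolynomial (Fin n) K) :=
  I.map (changeCoord g)

/-- Zariski open subsets of `GL_n(K)`, a subspace of the affine space of all `n × n` matrices: the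
complement of `U` in `GL_n(K)` is the common zero set of an ideal of polynomials in the matrix
entries. -/
def IsZariskiOpen {K : Type*} [Field K] {n : ℕ} (U : Set (GL (Fin n) K)) : Prop :=
  ∃ A : Ideal (MvPolynomial (Fin n × Fin n) K),
    U = {g | (fun p : Fin n × Fin n => g.val p.1 p.2) ∉ zeroLocus K A}

/-- `P` holds for a general `g ∈ GL_n(K)`: it holds on a non-empty Zariski open subset. -/
def ForGeneral {K : Type*} [Field K] {n : ℕ} (P : GL (Fin n) K → Prop) : Prop :=
  ∃ U : Set (GL (Fin n) K), IsZariskiOpen U ∧ U.Nonempty ∧ ∀ g ∈ U, P g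

/-- The initial ideal of `I`: the ideal generated by the leading terms of the elements of `I`. -/
def initialIdeal {K : Type*} [Field K] {n : ℕ} (m : MonomialOrder (Fin n))
    (I : Ideal (MvPolynomial (Fin n) K)) : Ideal (MvPolynomial (Fin n) K) :=
  Ideal.span (m.leadingTerm '' (I : Set (MvPolynomial (Fin n) K)))

/-- `L` is a generic initial ideal of `I`: `L` is the initial ideal of `g(I)` for general `g`. -/
def IsGin {K : Type*} [Field K] {n : ℕ} (m : MonomialOrder (Fin n))
    (I L : Ideal (MvPolynomial (Fin n) K)) : Prop :=
  ForGeneral fun g : GL (Fin n) K => initialIdeal m (actIdeal g I) = L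

/-- The generic initial ideal of `I`: the ideal `L` with `IsGin m I L`. For `K` infinite and `I`
homogeneous there is exactly one such `L`, so the value that `Classical.epsilon` takes when there is
none plays no role. -/
def gin {K : Type*} [Field K] {n : ℕ} (m : MonomialOrder (Fin n))
    (I : Ideal (MvPolynomial (Fin n) K)) : Ideal (MvPolynomial (Fin n) K) :=
  Classical.epsilon fun L => IsGin m I L

/-- The lexicographic order induced by `x_1 > x_2 > ⋯ > x_n`. -/
def lexOrder (n : ℕ) : MonomialOrder (Fin n) :=
  MonomialOrder.lex

/-- The opposite lexicographic order: the lexicographic order induced by `x_n > ⋯ > x_2 > x_1`. -/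
def oplexOrder (n : ℕ) : MonomialOrder (Fin n) where
  syn := (MonomialOrder.lex (σ := (Fin n)ᵒᵈ)).syn
  toSyn := (Finsupp.domCongr (OrderDual.toDual : Fin n ≃ (Fin n)ᵒᵈ)).trans
    (MonomialOrder.lex (σ := (Fin n)ᵒᵈ)).toSyn
  toSyn_monotone := by
    intro a b h
    refine (MonomialOrder.lex (σ := (Fin n)ᵒᵈ)).toSyn_monotone ?_
    intro i
    exact h (OrderDual.ofDual i)

end GeneralIntersections

end

noncomputable section

namespace GeneralIntersections

attribute [local instance] MvPolynomial.gradedAlgebra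

/-! ### Leading exponents over a domain -/

section CommRing

variable {σ τ R S : Type*} [CommRing R] [CommRing S]

/-! The gins are initial ideals of `g₁(I)` and `g₂(J)` for suitable coordinates, and nothing more
about them is needed. In each degree, a one-parameter torus whose weights reverse the term order
degenerates an ideal to its initial ideal as `t → 0`. Using two tori with the same `t`, one for lex
and one for oplex, makes the sum and the product of the moved ideals contain families of forms whose
values at `t = 0` are the monomials of the sum and the product of the initial ideals
(`exists_degeneration`). Linear independence is an open condition, so for some `t ≠ 0` the Hilbert
function is at least that of the monomial ideal (`exists_ncard_le_hilbert`). Undoing the first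
coordinate change gives `I + h(J)` or `I h(J)` for some `h`.

This `h` depends on the degree, but a general `g` maximises the Hilbert function in all degrees at
once (`forGeneral_hilbert_map_specialize_le`). That proves (ii). For (i), the lower bound on `I +
g(J)` becomes an upper bound on `I ∩ g(J)` by the dimension formula, since passing to initial ideals
preserves Hilbert functions (`hilbert_eq_ncard`). -/

theorem isHomogeneous_map_ideal (φ : MvPolynomial σ R →+* MvPolynomial τ S)
    (hφ : ∀ d p, p.IsHomogeneous d → (φ p).IsHomogeneous d) {I : Ideal (MvPolynomial σ R)}
    (hI : I.IsHomogeneous (homogeneousSubmodule σ R)) :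
    (I.map φ).IsHomogeneous (homogeneousSubmodule τ S) := by
  obtain ⟨T, rfl⟩ := (Ideal.IsHomogeneous.iff_exists _ _).1 hI
  rw [Ideal.map_span]
  refine Ideal.homogeneous_span _ _ ?_
  rintro _ ⟨_, ⟨x, -, rfl⟩, rfl⟩
  obtain ⟨d, hd⟩ := x.2
  exact ⟨d, hφ d _ hd⟩

/-- The exponents of the leading monomials of the nonzero elements of an ideal. -/
def leadingExponents (m : MonomialOrder σ) (I : Ideal (MvPolynomial σ R)) : Set (σ →₀ ℕ) :=
  {a | ∃ f ∈ I, f ≠ 0 ∧ m.degree f = a}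

/-- The exponents of total degree `d` in a set of exponents. -/
def degreeSlice (E : Set (σ →₀ ℕ)) (d : ℕ) : Set (σ →₀ ℕ) :=
  {a ∈ E | a.degree = d}

theorem finite_degreeSlice [Finite σ] (E : Set (σ →₀ ℕ)) (d : ℕ) : (degreeSlice E d).Finite :=
  (Finsupp.finite_of_degree_eq d).subset fun _ h => h.2

theorem degree_eq_of_coeff_ne_zero (m : MonomialOrder σ) {f : MvPolynomial σ R} {a : σ →₀ ℕ}
    (ha : f.coeff a ≠ 0) (h : ∀ b, f.coeff b ≠ 0 → m.toSyn b ≤ m.toSyn a) : m.degree f = a := by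
  refine m.toSyn.injective (le_antisymm ?_ (m.le_degree (mem_support_iff.2 ha)))
  exact m.degree_le_iff.2 fun b hb => h b (mem_support_iff.1 hb)

/-- The order need not refine total degree, but passing to the homogeneous component through the
leading monomial only discards other terms. -/
theorem exists_isHomogeneous_of_mem_leadingExponents {m : MonomialOrder σ}
    {I : Ideal (MvPolynomial σ R)} (hI : I.IsHomogeneous (homogeneousSubmodule σ R))
    {a : σ →₀ ℕ} (ha : a ∈ leadingExponents m I) :
    ∃ f ∈ I, f ≠ 0 ∧ f.IsHomogeneous a.degree ∧ m.degree f = a := by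
  obtain ⟨f, hf, h0, rfl⟩ := ha
  have hc : (homogeneousComponent (m.degree f).degree f).coeff (m.degree f) ≠ 0 := by
    rw [coeff_homogeneousComponent, if_pos rfl]
    exact m.coeff_degree_ne_zero_iff.2 h0
  refine ⟨homogeneousComponent (m.degree f).degree f, homogeneousComponent_mem_of_mem hI hf _, ?_,
    homogeneousComponent_isHomogeneous _ _, degree_eq_of_coeff_ne_zero m hc fun b hb => ?_⟩
  · rintro h
    simp [h] at hc
  · rw [coeff_homogeneousComponent] at hb
    refine m.le_degree (mem_support_iff.2 ?_)
    split_ifs at hb with h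
    · exact hb
    · exact absurd rfl hb

theorem isUpperSet_leadingExponents [IsDomain R] (m : MonomialOrder σ)
    (I : Ideal (MvPolynomial σ R)) : IsUpperSet (leadingExponents m I) := by
  rintro a b hab ⟨f, hf, h0, rfl⟩
  have hm : monomial (b - m.degree f) (1 : R) ≠ 0 := by simp
  refine ⟨monomial (b - m.degree f) 1 * f, I.mul_mem_left _ hf, mul_ne_zero hm h0, ?_⟩
  classical
  rw [m.degree_mul hm h0, m.degree_monomial, if_neg one_ne_zero]
  exact tsub_add_cancel_of_le hab

/-- Reading off coefficients at the leading exponents of degree `d` is injective on the span,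
because a nonzero element is detected by its own leading coefficient. No division occurs, so `R` may
be the polynomial ring in the matrix entries. -/
theorem card_le_ncard_leadingExponents [IsDomain R] [Finite σ] (m : MonomialOrder σ)
    {I : Ideal (MvPolynomial σ R)} {d : ℕ} {ι : Type*} [Fintype ι] {v : ι → MvPolynomial σ R}
    (hv : LinearIndependent R v) (hI : ∀ i, v i ∈ I) (hd : ∀ i, (v i).IsHomogeneous d) :
    Fintype.card ι ≤ (degreeSlice (leadingExponents m I) d).ncard := by
  have := (finite_degreeSlice (leadingExponents m I) d).fintype
  rw [← Nat.card_coe_set_eq, Nat.card_eq_fintype_card]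
  let φ : (ι → R) →ₗ[R] (degreeSlice (leadingExponents m I) d → R) :=
    (LinearMap.pi fun a => lcoeff R a.1) ∘ₗ Fintype.linearCombination R v
  refine card_le_of_injective R φ ?_
  rw [← LinearMap.ker_eq_bot, LinearMap.ker_eq_bot']
  intro c hc
  have hz : Fintype.linearCombination R v c = 0 := by
    by_contra h0
    have hmem : Fintype.linearCombination R v c ∈ I := by
      rw [Fintype.linearCombination_apply]
      exact sum_mem fun i _ => by rw [smul_eq_C_mul]; exact I.mul_mem_left _ (hI i)
    have hhom : (Fintype.linearCombination R v c).IsHomogeneous d := by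
      rw [Fintype.linearCombination_apply]
      exact (homogeneousSubmodule σ R d).sum_mem fun i _ =>
        (homogeneousSubmodule σ R d).smul_mem _ (hd i)
    have hdeg : (m.degree (Fintype.linearCombination R v c)).degree = d := by
      by_contra h
      exact m.coeff_degree_ne_zero_iff.2 h0 (hhom.coeff_eq_zero h)
    have := congrFun hc ⟨m.degree (Fintype.linearCombination R v c), ⟨_, hmem, h0, rfl⟩, hdeg⟩
    exact m.coeff_degree_ne_zero_iff.2 h0 this
  exact funext fun i => Fintype.linearIndependent_iff.1 hv c
    (by rwa [Fintype.linearCombination_apply] at hz) i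

theorem linearIndependent_of_degree_injective [IsDomain R] (m : MonomialOrder σ) {ι : Type*}
    {v : ι → MvPolynomial σ R} (h0 : ∀ i, v i ≠ 0)
    (hinj : Function.Injective fun i => m.degree (v i)) : LinearIndependent R v := by
  classical
  rw [linearIndependent_iff']
  intro s c hs
  by_contra! hne
  obtain ⟨i, his, hi⟩ := hne
  obtain ⟨k, hk, hmax⟩ := (s.filter fun i => c i ≠ 0).exists_max_image
    (fun i => m.toSyn (m.degree (v i))) ⟨i, by simp [his, hi]⟩
  rw [Finset.mem_filter] at hk
  have := congrArg (coeff (m.degree (v k))) hs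
  rw [coeff_sum, coeff_zero, Finset.sum_eq_single k, coeff_smul, smul_eq_mul] at this
  · exact mul_ne_zero hk.2 (m.coeff_degree_ne_zero_iff.2 (h0 k)) this
  · intro j hj hjk
    rw [coeff_smul, smul_eq_mul]
    by_cases hc : c j = 0
    · rw [hc, zero_mul]
    · rw [m.coeff_eq_zero_of_lt, mul_zero]
      refine lt_of_le_of_ne (hmax j (by simp [hj, hc])) fun h => hjk (hinj (m.toSyn.injective h))
  · exact fun h => absurd hk.1 h

end CommRing

/-! ### Hilbert functions and monomial ideals -/

section Field

variable {K : Type*} [Field K] {n : ℕ}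

instance finite_degreePart (I : Ideal (MvPolynomial (Fin n) K)) (d : ℕ) :
    Module.Finite K (degreePart I d) := by
  have : Module.Finite K (homogeneousSubmodule (Fin n) K d) :=
    Module.Finite.iff_fg.2 (homogeneousSubmodule_fg _ _ d)
  exact Submodule.finiteDimensional_of_le inf_le_right

theorem card_le_hilbert {I : Ideal (MvPolynomial (Fin n) K)} {d : ℕ} {ι : Type*} [Fintype ι]
    {v : ι → MvPolynomial (Fin n) K} (hv : LinearIndependent K v) (hI : ∀ i, v i ∈ I)
    (hd : ∀ i, (v i).IsHomogeneous d) : Fintype.card ι ≤ hilbert I d := by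
  let w : ι → degreePart I d := fun i => ⟨v i, hI i, hd i⟩
  exact LinearIndependent.fintype_card_le_finrank (b := w)
    (LinearIndependent.of_comp (degreePart I d).subtype hv)

theorem exists_basis_degreePart (I : Ideal (MvPolynomial (Fin n) K)) (d : ℕ) :
    ∃ v : Fin (hilbert I d) → MvPolynomial (Fin n) K, LinearIndependent K v ∧ (∀ i, v i ∈ I) ∧
      ∀ i, (v i).IsHomogeneous d := by
  let b := Module.finBasis K (degreePart I d)
  exact ⟨fun i => b i, b.linearIndependent.map' (degreePart I d).subtype (Submodule.ker_subtype _),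
    fun i => (b i).2.1, fun i => (b i).2.2⟩

/-- Macaulay's theorem: a homogeneous ideal and its initial ideal have the same Hilbert function. -/
theorem hilbert_eq_ncard (m : MonomialOrder (Fin n)) {I : Ideal (MvPolynomial (Fin n) K)}
    (hI : IsHomogeneousIdeal I) (d : ℕ) :
    hilbert I d = (degreeSlice (leadingExponents m I) d).ncard := by
  apply le_antisymm
  · obtain ⟨v, hv, hvI, hvd⟩ := exists_basis_degreePart I d
    simpa using card_le_ncard_leadingExponents m hv hvI hvd
  · have := (finite_degreeSlice (leadingExponents m I) d).fintype
    rw [← Nat.card_coe_set_eq, Nat.card_eq_fintype_card]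
    choose f hf h0 hhom hdeg using fun a : degreeSlice (leadingExponents m I) d =>
      exists_isHomogeneous_of_mem_leadingExponents hI a.2.1
    refine card_le_hilbert (v := f) (linearIndependent_of_degree_injective m h0 ?_) hf
      fun a => a.2.2 ▸ hhom a
    intro a b hab
    exact Subtype.ext (by simpa only [hdeg] using hab)

theorem hilbert_inf_add_hilbert_sup_le {I J : Ideal (MvPolynomial (Fin n) K)}
    (hI : IsHomogeneousIdeal I) (hJ : IsHomogeneousIdeal J) (d : ℕ) :
    hilbert (I ⊓ J) d + hilbert (I ⊔ J) d ≤ hilbert I d + hilbert J d := by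
  have hinf : degreePart (I ⊓ J) d = degreePart I d ⊓ degreePart J d := by
    ext p
    simp only [degreePart, Submodule.mem_inf, Submodule.restrictScalars_mem]
    tauto
  have hsup : degreePart (I ⊔ J) d ≤ degreePart I d ⊔ degreePart J d := by
    rintro p ⟨hp, hpd⟩
    obtain ⟨a, ha, b, hb, rfl⟩ := Submodule.mem_sup.1 hp
    rw [← homogeneousComponent_eq_self hpd, map_add]
    exact Submodule.add_mem_sup
      ⟨homogeneousComponent_mem_of_mem hI ha d, homogeneousComponent_isHomogeneous _ _⟩
      ⟨homogeneousComponent_mem_of_mem hJ hb d, homogeneousComponent_isHomogeneous _ _⟩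
  have h := Submodule.finrank_sup_add_finrank_inf_eq (degreePart I d) (degreePart J d)
  have h' := Submodule.finrank_mono hsup
  unfold hilbert
  rw [hinf]
  omega

variable (K) in
/-- The ideal generated by the monomials with exponents in `E`. -/
def monomialIdeal (E : Set (Fin n →₀ ℕ)) : Ideal (MvPolynomial (Fin n) K) :=
  Ideal.span ((fun a => monomial a (1 : K)) '' E)

theorem isHomogeneousIdeal_monomialIdeal (E : Set (Fin n →₀ ℕ)) :
    IsHomogeneousIdeal (monomialIdeal K E) := by
  refine Ideal.homogeneous_span _ _ ?_
  rintro _ ⟨a, -, rfl⟩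
  exact ⟨a.degree, isHomogeneous_monomial _ rfl⟩

theorem mem_monomialIdeal {E : Set (Fin n →₀ ℕ)} (hE : IsUpperSet E)
    {p : MvPolynomial (Fin n) K} : p ∈ monomialIdeal K E ↔ ∀ a ∈ p.support, a ∈ E := by
  rw [monomialIdeal, mem_ideal_span_monomial_image]
  exact forall₂_congr fun a _ => ⟨fun ⟨b, hb, hba⟩ => hE hba hb, fun h => ⟨a, h, le_rfl⟩⟩

theorem leadingExponents_monomialIdeal (m : MonomialOrder (Fin n)) {E : Set (Fin n →₀ ℕ)}
    (hE : IsUpperSet E) : leadingExponents m (monomialIdeal K E) = E := by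
  classical
  ext a
  constructor
  · rintro ⟨f, hf, h0, rfl⟩
    exact (mem_monomialIdeal hE).1 hf _ (m.degree_mem_support h0)
  · intro ha
    refine ⟨monomial a 1, Ideal.subset_span ⟨a, ha, rfl⟩, by simp, ?_⟩
    rw [m.degree_monomial, if_neg one_ne_zero]

theorem hilbert_monomialIdeal {E : Set (Fin n →₀ ℕ)} (hE : IsUpperSet E) (d : ℕ) :
    hilbert (monomialIdeal K E) d = (degreeSlice E d).ncard := by
  rw [hilbert_eq_ncard (lexOrder n) (isHomogeneousIdeal_monomialIdeal E),
    leadingExponents_monomialIdeal _ hE]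

theorem monomialIdeal_inf {E F : Set (Fin n →₀ ℕ)} (hE : IsUpperSet E) (hF : IsUpperSet F) :
    monomialIdeal K E ⊓ monomialIdeal K F = monomialIdeal K (E ∩ F) := by
  ext p
  rw [Submodule.mem_inf, mem_monomialIdeal hE, mem_monomialIdeal hF,
    mem_monomialIdeal (hE.inter hF)]
  exact ⟨fun h a ha => ⟨h.1 a ha, h.2 a ha⟩, fun h => ⟨fun a ha => (h a ha).1, fun a ha => (h a ha).2⟩⟩

theorem monomialIdeal_mul (E F : Set (Fin n →₀ ℕ)) :
    monomialIdeal K E * monomialIdeal K F = monomialIdeal K (Set.image2 (· + ·) E F) := by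
  rw [monomialIdeal, monomialIdeal, monomialIdeal, Ideal.span_mul_span']
  congr 1
  ext p
  simp only [Set.mem_mul, Set.mem_image, Set.mem_image2]
  constructor
  · rintro ⟨_, ⟨a, ha, rfl⟩, _, ⟨b, hb, rfl⟩, rfl⟩
    exact ⟨a + b, ⟨a, ha, b, hb, rfl⟩, by simp [monomial_mul]⟩
  · rintro ⟨_, ⟨a, ha, b, hb, rfl⟩, rfl⟩
    exact ⟨_, ⟨a, ha, rfl⟩, _, ⟨b, hb, rfl⟩, by simp [monomial_mul]⟩

theorem isUpperSet_image2_add {E F : Set (Fin n →₀ ℕ)} (hE : IsUpperSet E) :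
    IsUpperSet (Set.image2 (· + ·) E F) := by
  rintro _ c hc ⟨a, ha, b, hb, rfl⟩
  have hbc : b ≤ c := le_trans le_add_self hc
  exact ⟨c - b, hE (le_tsub_of_add_le_right hc) ha, b, hb, tsub_add_cancel_of_le hbc⟩

theorem initialIdeal_eq_monomialIdeal (m : MonomialOrder (Fin n))
    (I : Ideal (MvPolynomial (Fin n) K)) :
    initialIdeal m I = monomialIdeal K (leadingExponents m I) := by
  refine le_antisymm (Ideal.span_le.2 ?_) (Ideal.span_le.2 ?_)
  · rintro _ ⟨f, hf, rfl⟩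
    by_cases h0 : f = 0
    · simp [h0]
    · have : m.leadingTerm f = C (m.leadingCoeff f) * monomial (m.degree f) 1 := by
        rw [C_mul_monomial, mul_one, MonomialOrder.leadingTerm]
      rw [this]
      exact Ideal.mul_mem_left _ _ (Ideal.subset_span ⟨_, ⟨f, hf, h0, rfl⟩, rfl⟩)
  · rintro _ ⟨_, ⟨f, hf, h0, rfl⟩, rfl⟩
    have hc : m.leadingCoeff f ≠ 0 := m.leadingCoeff_ne_zero_iff.2 h0
    have : monomial (m.degree f) (1 : K) = C (m.leadingCoeff f)⁻¹ * m.leadingTerm f := by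
      rw [MonomialOrder.leadingTerm, C_mul_monomial, inv_mul_cancel₀ hc]
    simp only [this]
    exact Ideal.mul_mem_left _ _ (Ideal.subset_span ⟨f, hf, rfl⟩)

end Field

-- Genericity and semicontinuity

universe u

/-- If polynomials over a `K`-algebra `S` become linearly independent at one `K`-point of `S`, then
they are linearly independent at every point where some fixed element of `S` does not vanish. -/
theorem exists_linearIndependent_map {K S : Type u} [Field K] [CommRing S] [Algebra K S]
    {σ : Type*} (ε : S →+* K) (hε : ∀ c, ε (algebraMap K S c) = c) {ι : Type*} [Fintype ι]
    (f : ι → MvPolynomial σ S) (hf : LinearIndependent K fun i => map ε (f i)) :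
    ∃ D : S, ε D = 1 ∧ ∀ (T : Type u) [CommRing T] [IsDomain T] (ψ : S →+* T), ψ D ≠ 0 →
      LinearIndependent T fun i => map ψ (f i) := by
  classical
  obtain ⟨L, hL⟩ := LinearMap.exists_leftInverse_of_injective
    (Fintype.linearCombination K fun i => map ε (f i))
    (LinearMap.ker_eq_bot'.2 fun c hc => funext fun i => Fintype.linearIndependent_iff.1 hf c
      (by rwa [Fintype.linearCombination_apply] at hc) i)
  have hL' : ∀ i, L (map ε (f i)) = Pi.single i 1 := by
    intro i
    have := LinearMap.congr_fun hL (Pi.single i 1)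
    simpa [Fintype.linearCombination_apply_single] using this
  let A : Finset (σ →₀ ℕ) := Finset.univ.biUnion fun i => (f i).support
  have hA : ∀ i, (f i).support ⊆ A := fun i =>
    Finset.subset_biUnion_of_mem (fun i => (f i).support) (Finset.mem_univ i)
  -- The left inverse `L` over `K`, lifted to constants of `S` and applied to the `f i`: its matrix
  -- specialises to the identity under `ε`, so its determinant is the required `D`.
  let M : Matrix ι ι S := Matrix.of fun j i =>
    ∑ a ∈ A, algebraMap K S (L (monomial a 1) j) * (f i).coeff a
  have hM : M.map ε = 1 := by
    ext j i
    have h1 : map ε (f i) = ∑ a ∈ A, ε ((f i).coeff a) • monomial a (1 : K) := by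
      ext b
      simp only [coeff_map, coeff_sum, coeff_smul, coeff_monomial, smul_eq_mul, mul_ite, mul_one,
        mul_zero, Finset.sum_ite_eq']
      split_ifs with hb
      · rfl
      · rw [notMem_support_iff.1 fun h => hb (hA i h), map_zero]
    have h2 := congrFun (hL' i) j
    rw [h1, map_sum] at h2
    simp only [Matrix.map_apply, M, Matrix.of_apply, map_sum, map_mul, hε]
    rw [Finset.sum_apply] at h2
    simp only [map_smul, Pi.smul_apply, smul_eq_mul] at h2
    rw [Matrix.one_apply, ← Pi.single_apply, ← h2]
    exact Finset.sum_congr rfl fun _ _ => mul_comm _ _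
  refine ⟨M.det, ?_, fun T _ _ ψ hψ => ?_⟩
  · rw [RingHom.map_det, RingHom.mapMatrix_apply, hM, Matrix.det_one]
  · rw [Fintype.linearIndependent_iff]
    intro g hg
    have hdet : (M.map ψ).det ≠ 0 := by
      rwa [← RingHom.mapMatrix_apply, ← RingHom.map_det]
    have hv : (M.map ψ).mulVec g = 0 := by
      ext j
      simp only [Matrix.mulVec, dotProduct, Matrix.map_apply, M, Matrix.of_apply, map_sum, map_mul,
        Finset.sum_mul, Pi.zero_apply]
      rw [Finset.sum_comm]
      refine Finset.sum_eq_zero fun a _ => ?_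
      have := congrArg (coeff a) hg
      simp only [coeff_sum, coeff_smul, coeff_map, smul_eq_mul, coeff_zero] at this
      simp only [mul_assoc]
      rw [← Finset.mul_sum]
      simp only [mul_comm (ψ _) (g _)]
      rw [this, mul_zero]
    exact fun i => congrFun (Matrix.eq_zero_of_mulVec_eq_zero hdet hv) i

section

variable {K : Type u} [Field K] {n : ℕ}

/-- Evaluation of a polynomial in the matrix entries at a matrix. -/
def evalEntries (g : GL (Fin n) K) : MvPolynomial (Fin n × Fin n) K →+* K :=
  eval fun p => g.val p.1 p.2

/-- Specialisation of polynomials whose coefficients are polynomials in the matrix entries. -/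
def specialize (g : GL (Fin n) K) :
    MvPolynomial (Fin n) (MvPolynomial (Fin n × Fin n) K) →+* MvPolynomial (Fin n) K :=
  map (evalEntries g)

/-- Over an infinite field, a nonzero polynomial times the generic determinant has a nonzero value,
so every nonempty basic open set of matrices meets `GL`. -/
theorem forGeneral_iff [Infinite K] {P : GL (Fin n) K → Prop} :
    ForGeneral P ↔ ∃ p : MvPolynomial (Fin n × Fin n) K, p ≠ 0 ∧
      ∀ g, evalEntries g p ≠ 0 → P g := by
  constructor
  · rintro ⟨_, ⟨A, rfl⟩, ⟨g, hg⟩, hP⟩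
    simp only [Set.mem_ofPred_eq, mem_zeroLocus_iff, not_forall] at hg hP
    obtain ⟨p, hp, hpg⟩ := hg
    refine ⟨p, ?_, fun h hh => hP h ⟨p, hp, by rwa [aeval_eq_eval]⟩⟩
    rintro rfl
    simp at hpg
  · rintro ⟨p, hp, hP⟩
    refine ⟨_, ⟨Ideal.span {p}, rfl⟩, ?_, ?_⟩
    · have hne : p * (Matrix.of fun i j => X (i, j) : Matrix (Fin n) (Fin n) _).det ≠ 0 :=
        mul_ne_zero hp (Matrix.det_mvPolynomialX_ne_zero (Fin n) K)
      obtain ⟨x, hx⟩ : ∃ x, eval x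
          (p * (Matrix.of fun i j => X (i, j) : Matrix (Fin n) (Fin n) _).det) ≠ 0 := by
        by_contra! h
        exact hne (MvPolynomial.funext fun x => by rw [h x, map_zero])
      rw [map_mul, RingHom.map_det] at hx
      refine ⟨Matrix.GeneralLinearGroup.mkOfDetNeZero (Matrix.of fun i j => x (i, j)) ?_, ?_⟩
      · convert right_ne_zero_of_mul hx using 2
        ext i j
        simp
      · simp only [Set.mem_ofPred_eq, mem_zeroLocus_iff, not_forall]
        refine ⟨p, Ideal.subset_span rfl, ?_⟩
        rw [aeval_eq_eval]
        exact left_ne_zero_of_mul hx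
    · intro g hg
      refine hP g fun h => hg ?_
      intro q hq
      obtain ⟨r, rfl⟩ := Ideal.mem_span_singleton.1 hq
      rw [map_mul, aeval_eq_eval]
      exact mul_eq_zero_of_left h _

theorem ForGeneral.and [Infinite K] {P Q : GL (Fin n) K → Prop} (hP : ForGeneral P)
    (hQ : ForGeneral Q) : ForGeneral fun g => P g ∧ Q g := by
  rw [forGeneral_iff] at *
  obtain ⟨p, hp, hP⟩ := hP
  obtain ⟨q, hq, hQ⟩ := hQ
  refine ⟨p * q, mul_ne_zero hp hq, fun g hg => ?_⟩
  rw [map_mul] at hg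
  exact ⟨hP g (left_ne_zero_of_mul hg), hQ g (right_ne_zero_of_mul hg)⟩

theorem ForGeneral.mono {P Q : GL (Fin n) K → Prop} (hP : ForGeneral P) (h : ∀ g, P g → Q g) :
    ForGeneral Q := by
  obtain ⟨U, hU, hne, hP⟩ := hP
  exact ⟨U, hU, hne, fun g hg => h g (hP g hg)⟩

theorem ForGeneral.exists {P : GL (Fin n) K → Prop} (hP : ForGeneral P) : ∃ g, P g := by
  obtain ⟨U, -, ⟨g, hg⟩, hP⟩ := hP
  exact ⟨g, hP g hg⟩

/-- Dickson's lemma, from the Hilbert basis theorem for a monomial ideal. -/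
theorem exists_finset_forall_exists_le (K : Type u) [Field K] (E : Set (Fin n →₀ ℕ)) :
    ∃ F : Finset (Fin n →₀ ℕ), ↑F ⊆ E ∧ ∀ a ∈ E, ∃ b ∈ F, b ≤ a := by
  classical
  obtain ⟨T, hT, hspan⟩ := (Submodule.fg_span_iff_fg_span_finset_subset _).1
    ((isNoetherianRing_iff_ideal_fg _).1 inferInstance (monomialIdeal K E))
  obtain ⟨F, hF, rfl⟩ := Finset.subset_set_image_iff.1 hT
  refine ⟨F, hF, fun a ha => ?_⟩
  have hmem : monomial a (1 : K) ∈ monomialIdeal K (F : Set (Fin n →₀ ℕ)) := by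
    have : monomial a (1 : K) ∈ monomialIdeal K E := Ideal.subset_span ⟨a, ha, rfl⟩
    unfold monomialIdeal at this ⊢
    rw [Ideal.span, hspan] at this
    simpa using this
  rw [monomialIdeal, mem_ideal_span_monomial_image] at hmem
  simpa using hmem a (by simp)

/-- A leading exponent survives wherever its leading coefficient does not vanish. Finitely many
exponents generate all of them, so one open set serves every degree. -/
theorem leadingExponents_subset_map [Infinite K] (m : MonomialOrder (Fin n))
    (F : Ideal (MvPolynomial (Fin n) (MvPolynomial (Fin n × Fin n) K))) :
    ForGeneral fun g : GL (Fin n) K =>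
      leadingExponents m F ⊆ leadingExponents m (F.map (specialize g)) := by
  obtain ⟨T, hT, hle⟩ := exists_finset_forall_exists_le K (leadingExponents m F)
  choose f hf h0 hdeg using fun a : T => hT a.2
  rw [forGeneral_iff]
  refine ⟨∏ a, m.leadingCoeff (f a),
    Finset.prod_ne_zero_iff.2 fun a _ => m.leadingCoeff_ne_zero_iff.2 (h0 a), fun g hg b hb => ?_⟩
  rw [map_prod, Finset.prod_ne_zero_iff] at hg
  obtain ⟨a, ha, hab⟩ := hle b hb
  refine isUpperSet_leadingExponents m _ hab ?_
  have hc : (specialize g (f ⟨a, ha⟩)).coeff a ≠ 0 := by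
    rw [specialize, coeff_map]
    convert hg ⟨a, ha⟩ (Finset.mem_univ _)
    rw [MonomialOrder.leadingCoeff, hdeg]
  refine ⟨_, Ideal.mem_map_of_mem _ (hf ⟨a, ha⟩), fun h => ?_,
    degree_eq_of_coeff_ne_zero m hc fun b hb => ?_⟩
  · rw [h, coeff_zero] at hc
    exact hc rfl
  · rw [specialize, coeff_map] at hb
    have := m.le_degree (mem_support_iff.2 fun h => hb (by rw [h, map_zero]) :
      b ∈ (f ⟨a, ha⟩).support)
    rwa [hdeg] at this

theorem map_homogeneousComponent {σ R S : Type*} [CommRing R] [CommRing S] (φ : R →+* S) (d : ℕ)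
    (p : MvPolynomial σ R) : map φ (homogeneousComponent d p) = homogeneousComponent d (map φ p) := by
  ext a
  rw [coeff_map, coeff_homogeneousComponent, coeff_homogeneousComponent, coeff_map]
  split_ifs <;> simp

/-- A basis of the special fibre lifts to forms of `F`. Independence at the point `g` forces
independence over the ring of matrix entries, where leading exponents bound the number of forms. -/
theorem hilbert_map_specialize_le (m : MonomialOrder (Fin n))
    {F : Ideal (MvPolynomial (Fin n) (MvPolynomial (Fin n × Fin n) K))}
    (hF : F.IsHomogeneous (homogeneousSubmodule (Fin n) (MvPolynomial (Fin n × Fin n) K)))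
    (g : GL (Fin n) K) (d : ℕ) :
    hilbert (F.map (specialize g)) d ≤ (degreeSlice (leadingExponents m F) d).ncard := by
  obtain ⟨v, hv, hvF, hvd⟩ := exists_basis_degreePart (F.map (specialize g)) d
  have hev : Function.Surjective (evalEntries g) := fun c => ⟨C c, eval_C c⟩
  have hlift : ∀ i, ∃ f ∈ F, f.IsHomogeneous d ∧ specialize g f = v i := by
    intro i
    obtain ⟨f, hf, hfv⟩ := (Ideal.mem_map_iff_of_surjective _ (map_surjective _ hev)).1 (hvF i)
    refine ⟨homogeneousComponent d f, homogeneousComponent_mem_of_mem hF hf d,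
      homogeneousComponent_isHomogeneous _ _, ?_⟩
    rw [specialize, map_homogeneousComponent]
    exact (congrArg _ hfv).trans (homogeneousComponent_eq_self (hvd i))
  choose f hf hfd hfv using hlift
  obtain ⟨D, hD, hind⟩ := exists_linearIndependent_map (evalEntries g) (fun c => eval_C c) f
    (by convert hv using 2 with i; exact hfv i)
  have hfi := hind _ (RingHom.id _) (by rintro rfl; simp at hD)
  simp only [map_id] at hfi
  simpa using card_le_ncard_leadingExponents m hfi hf hfd

/-- The Hilbert functions of the specialisations of `F` are maximal at general points, in all
degrees simultaneously. -/
theorem forGeneral_hilbert_map_specialize_le [Infinite K]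
    {F : Ideal (MvPolynomial (Fin n) (MvPolynomial (Fin n × Fin n) K))}
    (hF : F.IsHomogeneous (homogeneousSubmodule (Fin n) (MvPolynomial (Fin n × Fin n) K))) :
    ForGeneral fun g : GL (Fin n) K => ∀ h d,
      hilbert (F.map (specialize h)) d ≤ hilbert (F.map (specialize g)) d := by
  refine (leadingExponents_subset_map (lexOrder n) F).mono fun g hg h d => ?_
  refine (hilbert_map_specialize_le (lexOrder n) hF h d).trans ?_
  rw [hilbert_eq_ncard (lexOrder n)
    (isHomogeneous_map_ideal (specialize g) (fun _ _ hp => hp.map _) hF)]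
  exact Set.ncard_le_ncard (fun a ha => ⟨hg ha.1, ha.2⟩) (finite_degreeSlice _ _)

/-! ### Families of ideals over the matrix entries -/

/-- The coordinate change by the matrix of indeterminates. -/
def genericChangeCoord (K : Type u) [Field K] (n : ℕ) :
    MvPolynomial (Fin n) K →ₐ[K] MvPolynomial (Fin n) (MvPolynomial (Fin n × Fin n) K) :=
  aeval fun i => ∑ j, C (X (j, i)) * X j

theorem specialize_comp_genericChangeCoord (g : GL (Fin n) K) :
    (specialize g).comp (genericChangeCoord K n : MvPolynomial (Fin n) K →+* _) =
      (changeCoord g : MvPolynomial (Fin n) K →+* _) := by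
  refine MvPolynomial.ringHom_ext (fun c => ?_) fun i => ?_
  · have : (algebraMap K (MvPolynomial (Fin n) (MvPolynomial (Fin n × Fin n) K))) c = C (C c) := rfl
    simp [genericChangeCoord, changeCoord, specialize, evalEntries, algHom_C, this]
  · simp [genericChangeCoord, changeCoord, specialize, evalEntries]

theorem isHomogeneous_sum_C_mul_X {R : Type*} [CommRing R] (c : Fin n → R) :
    (∑ j, C (c j) * X j : MvPolynomial (Fin n) R).IsHomogeneous 1 :=
  IsHomogeneous.sum _ _ _ fun _ _ => isHomogeneous_C_mul_X _ _

theorem isHomogeneous_changeCoord (g : GL (Fin n) K) {p : MvPolynomial (Fin n) K} {d : ℕ}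
    (hp : p.IsHomogeneous d) : (changeCoord g p).IsHomogeneous d := by
  have h := hp.aeval (fun i => ∑ j, C (g.val j i) * X j)
    (n := 1) (fun i => isHomogeneous_sum_C_mul_X _)
  rw [one_mul] at h
  exact h

theorem actIdeal_eq_map (g : GL (Fin n) K) (I : Ideal (MvPolynomial (Fin n) K)) :
    actIdeal g I = I.map (changeCoord g : MvPolynomial (Fin n) K →+* MvPolynomial (Fin n) K) :=
  rfl

theorem isHomogeneousIdeal_actIdeal (g : GL (Fin n) K) {I : Ideal (MvPolynomial (Fin n) K)}
    (hI : IsHomogeneousIdeal I) : IsHomogeneousIdeal (actIdeal g I) := by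
  rw [actIdeal_eq_map]
  exact isHomogeneous_map_ideal _ (fun _ _ hp => isHomogeneous_changeCoord g hp) hI

/-- The ideal of the image of `I` under the coordinate change by the matrix of indeterminates. -/
def genericActIdeal (I : Ideal (MvPolynomial (Fin n) K)) :
    Ideal (MvPolynomial (Fin n) (MvPolynomial (Fin n × Fin n) K)) :=
  I.map (genericChangeCoord K n : MvPolynomial (Fin n) K →+* _)

theorem isHomogeneous_genericActIdeal {I : Ideal (MvPolynomial (Fin n) K)}
    (hI : IsHomogeneousIdeal I) :
    (genericActIdeal I).IsHomogeneous
      (homogeneousSubmodule (Fin n) (MvPolynomial (Fin n × Fin n) K)) := by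
  refine isHomogeneous_map_ideal _ (fun d p hp => ?_) hI
  have h := hp.eval₂ (algebraMap K (MvPolynomial (Fin n) (MvPolynomial (Fin n × Fin n) K)))
    (fun i => ∑ j, C (X (j, i)) * X j) (n := 1) (fun c => isHomogeneous_C _ (C c))
    (fun i => isHomogeneous_sum_C_mul_X _)
  rw [one_mul] at h
  exact h

theorem map_specialize_genericActIdeal (g : GL (Fin n) K) (I : Ideal (MvPolynomial (Fin n) K)) :
    (genericActIdeal I).map (specialize g) = actIdeal g I := by
  rw [genericActIdeal, Ideal.map_map, specialize_comp_genericChangeCoord]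
  rfl

/-- The ideal generated by `I` over the polynomial ring in the matrix entries. -/
def constIdeal (I : Ideal (MvPolynomial (Fin n) K)) :
    Ideal (MvPolynomial (Fin n) (MvPolynomial (Fin n × Fin n) K)) :=
  I.map (map (C : K →+* MvPolynomial (Fin n × Fin n) K))

theorem isHomogeneous_constIdeal {I : Ideal (MvPolynomial (Fin n) K)}
    (hI : IsHomogeneousIdeal I) :
    (constIdeal I).IsHomogeneous
      (homogeneousSubmodule (Fin n) (MvPolynomial (Fin n × Fin n) K)) :=
  isHomogeneous_map_ideal _ (fun _ _ hp => hp.map _) hI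

theorem map_specialize_constIdeal (g : GL (Fin n) K) (I : Ideal (MvPolynomial (Fin n) K)) :
    (constIdeal I).map (specialize g) = I := by
  have : (specialize g).comp (map (C : K →+* MvPolynomial (Fin n × Fin n) K)) =
      RingHom.id (MvPolynomial (Fin n) K) :=
    MvPolynomial.ringHom_ext (by simp [specialize, evalEntries]) (by simp [specialize])
  rw [constIdeal, Ideal.map_map, this, Ideal.map_id]

/-- Extension of ideals commutes with sums, so all the `I + g(J)` are specialisations of a single
ideal. -/
theorem forGeneral_hilbert_sup_actIdeal_le [Infinite K] {I J : Ideal (MvPolynomial (Fin n) K)}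
    (hI : IsHomogeneousIdeal I) (hJ : IsHomogeneousIdeal J) :
    ForGeneral fun g : GL (Fin n) K => ∀ h d,
      hilbert (I ⊔ actIdeal h J) d ≤ hilbert (I ⊔ actIdeal g J) d := by
  simpa only [Ideal.map_sup, map_specialize_constIdeal, map_specialize_genericActIdeal] using
    forGeneral_hilbert_map_specialize_le
      ((isHomogeneous_constIdeal hI).sup (isHomogeneous_genericActIdeal hJ))

theorem forGeneral_hilbert_mul_actIdeal_le [Infinite K] {I J : Ideal (MvPolynomial (Fin n) K)}
    (hI : IsHomogeneousIdeal I) (hJ : IsHomogeneousIdeal J) :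
    ForGeneral fun g : GL (Fin n) K => ∀ h d,
      hilbert (I * actIdeal h J) d ≤ hilbert (I * actIdeal g J) d := by
  simpa only [Ideal.map_mul, map_specialize_constIdeal, map_specialize_genericActIdeal] using
    forGeneral_hilbert_map_specialize_le
      (Ideal.IsHomogeneous.mul (isHomogeneous_constIdeal hI) (isHomogeneous_genericActIdeal hJ))

theorem changeCoord_changeCoord (g h : GL (Fin n) K) (p : MvPolynomial (Fin n) K) :
    changeCoord g (changeCoord h p) = changeCoord (g * h) p := by
  have : (changeCoord g).comp (changeCoord h) = changeCoord (g * h) := by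
    refine MvPolynomial.algHom_ext fun i => ?_
    simp only [changeCoord, AlgHom.comp_apply, aeval_X, map_sum, map_mul, algHom_C,
      algebraMap_eq, Finset.mul_sum, Units.val_mul,
      Matrix.mul_apply, Finset.sum_mul]
    rw [Finset.sum_comm]
    refine Finset.sum_congr rfl fun k _ => Finset.sum_congr rfl fun j _ => ?_
    ring
  exact DFunLike.congr_fun this p

theorem changeCoord_one (p : MvPolynomial (Fin n) K) : changeCoord (1 : GL (Fin n) K) p = p := by
  have : changeCoord (1 : GL (Fin n) K) = AlgHom.id K _ := by
    refine MvPolynomial.algHom_ext fun i => ?_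
    simp [changeCoord, Matrix.one_apply]
  rw [this, AlgHom.id_apply]

theorem actIdeal_actIdeal (g h : GL (Fin n) K) (I : Ideal (MvPolynomial (Fin n) K)) :
    actIdeal g (actIdeal h I) = actIdeal (g * h) I := by
  rw [actIdeal_eq_map, actIdeal_eq_map, actIdeal_eq_map, Ideal.map_map]
  congr 1
  exact RingHom.ext (changeCoord_changeCoord g h)

theorem actIdeal_one (I : Ideal (MvPolynomial (Fin n) K)) : actIdeal (1 : GL (Fin n) K) I = I := by
  have : (changeCoord (1 : GL (Fin n) K) : MvPolynomial (Fin n) K →+* MvPolynomial (Fin n) K) =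
      RingHom.id _ := RingHom.ext changeCoord_one
  rw [actIdeal_eq_map, this, Ideal.map_id]

theorem hilbert_actIdeal (g : GL (Fin n) K) (I : Ideal (MvPolynomial (Fin n) K)) (d : ℕ) :
    hilbert (actIdeal g I) d = hilbert I d := by
  have key : ∀ (g : GL (Fin n) K) (I : Ideal (MvPolynomial (Fin n) K)),
      hilbert I d ≤ hilbert (actIdeal g I) d := by
    intro g I
    obtain ⟨v, hv, hvI, hvd⟩ := exists_basis_degreePart I d
    have hinj : Function.Injective (changeCoord g) :=
      Function.LeftInverse.injective (g := changeCoord g⁻¹) fun p => by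
        rw [changeCoord_changeCoord, inv_mul_cancel, changeCoord_one]
    have h := card_le_hilbert (I := actIdeal g I) (hv.map' (changeCoord g).toLinearMap (LinearMap.ker_eq_bot.2 hinj))
      (fun i => Ideal.mem_map_of_mem (changeCoord g) (hvI i))
      (fun i => isHomogeneous_changeCoord g (hvd i))
    rwa [Fintype.card_fin] at h
  refine le_antisymm ?_ (key g I)
  simpa [actIdeal_actIdeal, actIdeal_one] using key g⁻¹ (actIdeal g I)

/-- Existence of generic initial ideals. -/
theorem exists_isGin [Infinite K] (m : MonomialOrder (Fin n)) {I : Ideal (MvPolynomial (Fin n) K)}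
    (hI : IsHomogeneousIdeal I) : ∃ L, IsGin m I L := by
  refine ⟨monomialIdeal K (leadingExponents m (genericActIdeal I)),
    (leadingExponents_subset_map m (genericActIdeal I)).mono fun g hg => ?_⟩
  rw [map_specialize_genericActIdeal] at hg
  rw [initialIdeal_eq_monomialIdeal]
  congr 1
  -- The generic exponents are contained in those of `g(I)`, and in each degree they are at least as
  -- numerous, so the finite slices coincide.
  refine (Set.Subset.antisymm hg fun a ha => ?_).symm
  have hle := hilbert_map_specialize_le m (isHomogeneous_genericActIdeal hI) g a.degree
  rw [map_specialize_genericActIdeal,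
    hilbert_eq_ncard m (isHomogeneousIdeal_actIdeal g hI)] at hle
  have hsub : degreeSlice (leadingExponents m (genericActIdeal I)) a.degree ⊆
      degreeSlice (leadingExponents m (actIdeal g I)) a.degree := fun b hb => ⟨hg hb.1, hb.2⟩
  have heq := Set.eq_of_subset_of_ncard_le hsub hle (finite_degreeSlice _ _)
  have hmem : a ∈ degreeSlice (leadingExponents m (actIdeal g I)) a.degree := ⟨ha, rfl⟩
  rw [← heq] at hmem
  exact hmem.1

theorem exists_gin_eq_initialIdeal [Infinite K] (m : MonomialOrder (Fin n))
    {I : Ideal (MvPolynomial (Fin n) K)} (hI : IsHomogeneousIdeal I) :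
    ∃ g : GL (Fin n) K, gin m I = initialIdeal m (actIdeal g I) := by
  have h : IsGin m I (gin m I) := Classical.epsilon_spec (exists_isGin m hI)
  obtain ⟨g, hg⟩ := ForGeneral.exists h
  exact ⟨g, hg.symm⟩

end

/-! ### Weights representing the two orders -/

section Weights

variable {n : ℕ}

/-- Among monomials of the same degree, at most `d`, the larger ones for `m` have the smaller weight
for `w`. -/
def ReversedByWeight (m : MonomialOrder (Fin n)) (w : Fin n → ℕ) (d : ℕ) : Prop :=
  ∀ a b : Fin n →₀ ℕ, a.degree = b.degree → a.degree ≤ d → m.toSyn b < m.toSyn a →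
    Finsupp.weight w a < Finsupp.weight w b

/-- Comparison in base `d + 1`: the terms of lower rank in `b` have total exponent at most `d`, too
little to make up one unit at rank `ρ i`. -/
theorem sum_mul_pow_lt {ρ : Fin n → ℕ} {a b : Fin n →₀ ℕ} {d : ℕ}
    (hb : b.degree ≤ d) {i : Fin n} (hi : b i < a i)
    (hρ : ∀ j, j ≠ i → ρ j < ρ i ∨ a j = b j) :
    ∑ j, b j * (d + 1) ^ ρ j < ∑ j, a j * (d + 1) ^ ρ j := by
  -- The extra factor `d + 1` avoids the exponent `ρ i - 1`.
  have hterm : ∀ j ∈ Finset.univ.erase i,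
      b j * (d + 1) ^ ρ j * (d + 1) ≤ a j * (d + 1) ^ ρ j * (d + 1) + b j * (d + 1) ^ ρ i := by
    intro j hj
    rcases hρ j (Finset.ne_of_mem_erase hj) with h | h
    · rw [mul_assoc, ← pow_succ]
      exact le_add_left (Nat.mul_le_mul_left _ (Nat.pow_le_pow_right (Nat.succ_pos d) h))
    · rw [h]
      exact Nat.le_add_right _ _
  have hsum := Finset.sum_le_sum hterm
  rw [Finset.sum_add_distrib, ← Finset.sum_mul, ← Finset.sum_mul, ← Finset.sum_mul] at hsum
  have hbd : ∑ j ∈ Finset.univ.erase i, b j ≤ d := by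
    rw [Finsupp.degree_eq_sum] at hb
    exact (Finset.sum_le_sum_of_subset (Finset.erase_subset _ _)).trans hb
  rw [← Finset.add_sum_erase _ (fun j => b j * (d + 1) ^ ρ j) (Finset.mem_univ i),
    ← Finset.add_sum_erase _ (fun j => a j * (d + 1) ^ ρ j) (Finset.mem_univ i)]
  have hP : 0 < (d + 1) ^ ρ i := Nat.pow_pos (Nat.succ_pos d)
  have h1 : (∑ j ∈ Finset.univ.erase i, b j) * (d + 1) ^ ρ i ≤ d * (d + 1) ^ ρ i :=
    Nat.mul_le_mul_right _ hbd
  have h2 : (b i + 1) * (d + 1) ^ ρ i ≤ a i * (d + 1) ^ ρ i := Nat.mul_le_mul_right _ hi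
  generalize (d + 1) ^ ρ i = P at *
  generalize ∑ j ∈ Finset.univ.erase i, b j * (d + 1) ^ ρ j = s at *
  generalize ∑ j ∈ Finset.univ.erase i, a j * (d + 1) ^ ρ j = t at *
  nlinarith

/-- In a fixed total degree, subtracting from the constant `(d + 1) ^ n` reverses the comparison
while keeping the weights natural numbers. -/
theorem reversedByWeight_of_rank {m : MonomialOrder (Fin n)} {ρ : Fin n → ℕ} (hn : ∀ j, ρ j ≤ n)
    (hm : ∀ a b : Fin n →₀ ℕ, m.toSyn b < m.toSyn a →
      ∃ i, b i < a i ∧ ∀ j, j ≠ i → ρ j < ρ i ∨ a j = b j) (d : ℕ) :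
    ReversedByWeight m (fun j => (d + 1) ^ n - (d + 1) ^ ρ j) d := by
  intro a b hab had hlt
  obtain ⟨i, hi, hρ⟩ := hm a b hlt
  have h := sum_mul_pow_lt (hab ▸ had) hi hρ
  have key : ∀ c : Fin n →₀ ℕ, Finsupp.weight (fun j => (d + 1) ^ n - (d + 1) ^ ρ j) c +
      ∑ j, c j * (d + 1) ^ ρ j = c.degree * (d + 1) ^ n := by
    intro c
    rw [Finsupp.weight_eq_sum, Finsupp.degree_eq_sum, ← Finset.sum_add_distrib, Finset.sum_mul]
    refine Finset.sum_congr rfl fun j _ => ?_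
    rw [smul_eq_mul, ← mul_add, Nat.sub_add_cancel (Nat.pow_le_pow_right (Nat.succ_pos d) (hn j))]
  have ha := key a
  have hb := key b
  rw [hab] at ha
  omega

theorem exists_reversedByWeight_lexOrder (n d : ℕ) : ∃ w, ReversedByWeight (lexOrder n) w d := by
  -- Lex is decided at the smallest index that differs, so small indices get high rank.
  refine ⟨_, reversedByWeight_of_rank (ρ := fun j => n - j) (fun j => Nat.sub_le _ _) ?_ d⟩
  intro a b h
  obtain ⟨i, hi, hlt⟩ := Finsupp.Lex.lt_iff.1 (MonomialOrder.lex_lt_iff.1 h)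
  refine ⟨i, hlt, fun j hj => ?_⟩
  rcases lt_or_gt_of_ne hj with h | h
  · exact Or.inr (hi j h).symm
  · left
    have := j.2
    change n - j.1 < n - i.1
    omega

theorem exists_reversedByWeight_oplexOrder (n d : ℕ) :
    ∃ w, ReversedByWeight (oplexOrder n) w d := by
  refine ⟨_, reversedByWeight_of_rank (ρ := fun j => j) (fun j => j.2.le) ?_ d⟩
  intro a b h
  obtain ⟨i, hi, hlt⟩ := Finsupp.Lex.lt_iff.1 ((MonomialOrder.lex_lt_iff (σ := (Fin n)ᵒᵈ)
    (c := Finsupp.domCongr (OrderDual.toDual : Fin n ≃ (Fin n)ᵒᵈ) b)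
    (d := Finsupp.domCongr (OrderDual.toDual : Fin n ≃ (Fin n)ᵒᵈ) a)).1 h)
  refine ⟨OrderDual.ofDual i, hlt, fun j hj => ?_⟩
  rcases lt_or_gt_of_ne hj with h | h
  · exact Or.inl h
  · exact Or.inr (hi (OrderDual.toDual j) h).symm

end Weights

theorem ncard_degreeSlice_union_add_inter {σ : Type*} [Finite σ] (E F : Set (σ →₀ ℕ)) (d : ℕ) :
    (degreeSlice (E ∪ F) d).ncard + (degreeSlice (E ∩ F) d).ncard =
      (degreeSlice E d).ncard + (degreeSlice F d).ncard := by
  have hu : degreeSlice (E ∪ F) d = degreeSlice E d ∪ degreeSlice F d :=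
    Set.ext fun _ => or_and_right
  have hi : degreeSlice (E ∩ F) d = degreeSlice E d ∩ degreeSlice F d :=
    Set.ext fun _ => and_and_right
  rw [hu, hi, Set.ncard_union_add_ncard_inter _ _ (finite_degreeSlice E d) (finite_degreeSlice F d)]

/-! ### Torus degenerations to initial ideals -/

section Degeneration

variable {K : Type u} [Field K] {n : ℕ}

/-- The diagonal matrix with entries `t ^ w i`. -/
def torus (w : Fin n → ℕ) (t : Kˣ) : GL (Fin n) K :=
  Matrix.GeneralLinearGroup.mkOfDetNeZero (Matrix.diagonal fun i => (t : K) ^ w i) (by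
    rw [Matrix.det_diagonal]
    exact Finset.prod_ne_zero_iff.2 fun i _ => pow_ne_zero _ t.ne_zero)

theorem changeCoord_torus_X (w : Fin n → ℕ) (t : Kˣ) (i : Fin n) :
    changeCoord (torus w t) (X i) = C ((t : K) ^ w i) * X i := by
  have h : ∀ j, (torus w t).val j i = if j = i then (t : K) ^ w j else 0 := fun j =>
    Matrix.diagonal_apply _ _ _
  rw [changeCoord, aeval_X, Finset.sum_eq_single i]
  · rw [h, if_pos rfl]
  · intro j _ hj
    rw [h, if_neg hj, C_0, zero_mul]
  · simp

theorem changeCoord_torus_monomial (w : Fin n → ℕ) (t : Kˣ) (a : Fin n →₀ ℕ) (c : K) :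
    changeCoord (torus w t) (monomial a c) = monomial a (c * (t : K) ^ Finsupp.weight w a) := by
  rw [monomial_eq, map_mul, algHom_C, algebraMap_eq, monomial_eq, Finsupp.prod, map_prod]
  simp only [map_pow, changeCoord_torus_X, mul_pow]
  rw [Finset.prod_mul_distrib, C_mul, mul_assoc, Finsupp.weight_apply, Finsupp.sum,
    ← Finset.prod_pow_eq_pow_sum]
  simp only [map_prod, map_pow, smul_eq_mul, ← pow_mul, mul_comm (w _)]

/-- The torus scales the monomial `b` by `t ^ weight b`, and the leading monomial has strictly the
least weight. Dividing by that power of `t` and by the leading coefficient leaves a family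
polynomial in `t`, in which only the leading monomial survives at `t = 0`. -/
theorem exists_degeneration {m : MonomialOrder (Fin n)} {w : Fin n → ℕ} {d : ℕ}
    (hw : ReversedByWeight m w d) {I : Ideal (MvPolynomial (Fin n) K)} (hI : IsHomogeneousIdeal I)
    {a : Fin n →₀ ℕ} (ha : a ∈ leadingExponents m I) (had : a.degree ≤ d) :
    ∃ v : MvPolynomial (Fin n) (Polynomial K), v.IsHomogeneous a.degree ∧
      map (Polynomial.evalRingHom 0) v = monomial a 1 ∧
      ∀ t : Kˣ, map (Polynomial.evalRingHom (t : K)) v ∈ actIdeal (torus w t) I := by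
  obtain ⟨f, hf, h0, hhom, rfl⟩ := exists_isHomogeneous_of_mem_leadingExponents hI ha
  have hc : m.leadingCoeff f ≠ 0 := m.leadingCoeff_ne_zero_iff.2 h0
  have hlt : ∀ b ∈ f.support, b ≠ m.degree f →
      Finsupp.weight w (m.degree f) < Finsupp.weight w b := by
    intro b hb hne
    exact hw _ _ (hhom.degree_eq_sum_deg_support hb) had
      (lt_of_le_of_ne (m.le_degree hb) fun h => hne (m.toSyn.injective h))
  have hle : ∀ b ∈ f.support, Finsupp.weight w (m.degree f) ≤ Finsupp.weight w b := by
    intro b hb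
    by_cases h : b = m.degree f
    · rw [h]
    · exact (hlt b hb h).le
  refine ⟨∑ b ∈ f.support, monomial b (Polynomial.C ((m.leadingCoeff f)⁻¹ * f.coeff b) *
    Polynomial.X ^ (Finsupp.weight w b - Finsupp.weight w (m.degree f))), ?_, ?_, fun t => ?_⟩
  · exact IsHomogeneous.sum _ _ _ fun b hb =>
      isHomogeneous_monomial _ (hhom.degree_eq_sum_deg_support hb).symm
  · rw [map_sum, Finset.sum_eq_single (m.degree f)]
    · simp only [map_monomial, Polynomial.coe_evalRingHom, Polynomial.eval_C, Nat.sub_self,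
        pow_zero, mul_one]
      rw [show f.coeff (m.degree f) = m.leadingCoeff f from rfl, inv_mul_cancel₀ hc]
    · intro b hb hne
      simp [map_monomial, Nat.sub_ne_zero_of_lt (hlt b hb hne)]
    · exact fun h => absurd (m.degree_mem_support h0) h
  · have key : map (Polynomial.evalRingHom (t : K)) (∑ b ∈ f.support,
        monomial b (Polynomial.C ((m.leadingCoeff f)⁻¹ * f.coeff b) *
          Polynomial.X ^ (Finsupp.weight w b - Finsupp.weight w (m.degree f)))) =
        C ((m.leadingCoeff f)⁻¹ * ((t : K) ^ Finsupp.weight w (m.degree f))⁻¹) *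
          changeCoord (torus w t) f := by
      conv_rhs => enter [2]; rw [f.as_sum]
      rw [map_sum, map_sum, Finset.mul_sum]
      refine Finset.sum_congr rfl fun b hb => ?_
      rw [changeCoord_torus_monomial, map_monomial, C_mul_monomial]
      congr 1
      simp only [Polynomial.coe_evalRingHom, Polynomial.eval_mul, Polynomial.eval_C,
        Polynomial.eval_pow, Polynomial.eval_X]
      rw [pow_sub₀ _ t.ne_zero (hle b hb)]
      ring
    rw [key]
    exact Ideal.mul_mem_left _ _ (Ideal.mem_map_of_mem _ hf)

/-- The families specialise to distinct monomials at `t = 0`, hence stay independent wherever some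
nonzero polynomial `D` does not vanish. -/
theorem exists_ncard_le_hilbert [Infinite K] {E : Set (Fin n →₀ ℕ)} {d : ℕ}
    {F : Kˣ → Ideal (MvPolynomial (Fin n) K)}
    (h : ∀ a ∈ degreeSlice E d, ∃ v : MvPolynomial (Fin n) (Polynomial K), v.IsHomogeneous d ∧
      map (Polynomial.evalRingHom 0) v = monomial a 1 ∧
      ∀ t : Kˣ, map (Polynomial.evalRingHom (t : K)) v ∈ F t) :
    ∃ t, (degreeSlice E d).ncard ≤ hilbert (F t) d := by
  have := (finite_degreeSlice E d).fintype
  choose v hvd hv0 hvF using fun a : degreeSlice E d => h a a.2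
  obtain ⟨D, hD, hind⟩ := exists_linearIndependent_map (Polynomial.evalRingHom (0 : K))
    (fun c => by simp) v (by
      simp only [hv0]
      exact ((basisMonomials (Fin n) K).linearIndependent.comp _ Subtype.val_injective))
  -- The factor `X` excludes `t = 0`, where the torus is undefined.
  have hne : Polynomial.X * D ≠ 0 :=
    mul_ne_zero Polynomial.X_ne_zero (by rintro rfl; simp at hD)
  obtain ⟨t, ht⟩ : ∃ t : K, (Polynomial.X * D).eval t ≠ 0 := by
    by_contra! h
    exact hne (Polynomial.funext fun t => by rw [h t, Polynomial.eval_zero])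
  rw [Polynomial.eval_mul, Polynomial.eval_X] at ht
  refine ⟨Units.mk0 t (left_ne_zero_of_mul ht), ?_⟩
  rw [← Nat.card_coe_set_eq, Nat.card_eq_fintype_card]
  exact card_le_hilbert (hind K (Polynomial.evalRingHom t) (right_ne_zero_of_mul ht))
    (fun a => hvF a (Units.mk0 t (left_ne_zero_of_mul ht))) fun a => (hvd a).map _

theorem exists_ncard_union_le_hilbert_sup [Infinite K] {m₁ m₂ : MonomialOrder (Fin n)}
    {w₁ w₂ : Fin n → ℕ} {d : ℕ} (hw₁ : ReversedByWeight m₁ w₁ d) (hw₂ : ReversedByWeight m₂ w₂ d)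
    {I J : Ideal (MvPolynomial (Fin n) K)} (hI : IsHomogeneousIdeal I) (hJ : IsHomogeneousIdeal J) :
    ∃ t : Kˣ, (degreeSlice (leadingExponents m₁ I ∪ leadingExponents m₂ J) d).ncard ≤
      hilbert (actIdeal (torus w₁ t) I ⊔ actIdeal (torus w₂ t) J) d := by
  refine exists_ncard_le_hilbert ?_
  rintro a ⟨ha | ha, rfl⟩
  · obtain ⟨v, hv, h0, ht⟩ := exists_degeneration hw₁ hI ha le_rfl
    exact ⟨v, hv, h0, fun t => Ideal.mem_sup_left (ht t)⟩
  · obtain ⟨v, hv, h0, ht⟩ := exists_degeneration hw₂ hJ ha le_rfl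
    exact ⟨v, hv, h0, fun t => Ideal.mem_sup_right (ht t)⟩

/-- The degrees of the two factors vary with the monomial, while the tori must be fixed; this is why
`ReversedByWeight` covers all degrees up to `d`. -/
theorem exists_ncard_add_le_hilbert_mul [Infinite K] {m₁ m₂ : MonomialOrder (Fin n)}
    {w₁ w₂ : Fin n → ℕ} {d : ℕ} (hw₁ : ReversedByWeight m₁ w₁ d) (hw₂ : ReversedByWeight m₂ w₂ d)
    {I J : Ideal (MvPolynomial (Fin n) K)} (hI : IsHomogeneousIdeal I) (hJ : IsHomogeneousIdeal J) :
    ∃ t : Kˣ, (degreeSlice (Set.image2 (· + ·) (leadingExponents m₁ I)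
        (leadingExponents m₂ J)) d).ncard ≤
      hilbert (actIdeal (torus w₁ t) I * actIdeal (torus w₂ t) J) d := by
  refine exists_ncard_le_hilbert ?_
  rintro _ ⟨⟨a, ha, b, hb, rfl⟩, hd⟩
  have hd' : a.degree + b.degree = d := by rw [← hd, map_add]
  obtain ⟨v, hv, hv0, hvt⟩ := exists_degeneration hw₁ hI ha (by omega)
  obtain ⟨u, hu, hu0, hut⟩ := exists_degeneration hw₂ hJ hb (by omega)
  refine ⟨v * u, hd' ▸ hv.mul hu, ?_, fun t => ?_⟩
  · rw [map_mul, hv0, hu0, monomial_mul, one_mul]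
  · rw [map_mul]
    exact Ideal.mul_mem_mul (hvt t) (hut t)

theorem actIdeal_sup (g : GL (Fin n) K) (I J : Ideal (MvPolynomial (Fin n) K)) :
    actIdeal g (I ⊔ J) = actIdeal g I ⊔ actIdeal g J := by
  simp only [actIdeal_eq_map, Ideal.map_sup]

theorem actIdeal_mul (g : GL (Fin n) K) (I J : Ideal (MvPolynomial (Fin n) K)) :
    actIdeal g (I * J) = actIdeal g I * actIdeal g J := by
  simp only [actIdeal_eq_map, Ideal.map_mul]

/-- For each degree, some coordinate change `g` makes the Hilbert function of `I + g(J)` at least as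
large as that of the sum of initial ideals in other coordinates. -/
theorem exists_ncard_union_le_hilbert_sup_actIdeal [Infinite K]
    {I J : Ideal (MvPolynomial (Fin n) K)} (hI : IsHomogeneousIdeal I) (hJ : IsHomogeneousIdeal J)
    (g₁ g₂ : GL (Fin n) K) (d : ℕ) :
    ∃ g : GL (Fin n) K, (degreeSlice (leadingExponents (lexOrder n) (actIdeal g₁ I) ∪
      leadingExponents (oplexOrder n) (actIdeal g₂ J)) d).ncard ≤ hilbert (I ⊔ actIdeal g J) d := by
  obtain ⟨w₁, hw₁⟩ := exists_reversedByWeight_lexOrder n d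
  obtain ⟨w₂, hw₂⟩ := exists_reversedByWeight_oplexOrder n d
  obtain ⟨t, ht⟩ := exists_ncard_union_le_hilbert_sup hw₁ hw₂ (isHomogeneousIdeal_actIdeal g₁ hI)
    (isHomogeneousIdeal_actIdeal g₂ hJ)
  -- Applying `torus w₁ t * g₁` to `I + g(J)` moves `I` and `J` to the two degenerating positions
  -- without changing the Hilbert function.
  refine ⟨(torus w₁ t * g₁)⁻¹ * (torus w₂ t * g₂), ht.trans_eq ?_⟩
  rw [← hilbert_actIdeal (torus w₁ t * g₁) (I ⊔ _), actIdeal_sup, actIdeal_actIdeal,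
    actIdeal_actIdeal, actIdeal_actIdeal, mul_inv_cancel_left]

/-- For each degree, some coordinate change `g` makes the Hilbert function of `I g(J)` at least as
large as that of the product of initial ideals in other coordinates. -/
theorem exists_ncard_add_le_hilbert_mul_actIdeal [Infinite K]
    {I J : Ideal (MvPolynomial (Fin n) K)} (hI : IsHomogeneousIdeal I) (hJ : IsHomogeneousIdeal J)
    (g₁ g₂ : GL (Fin n) K) (d : ℕ) :
    ∃ g : GL (Fin n) K, (degreeSlice (Set.image2 (· + ·)
      (leadingExponents (lexOrder n) (actIdeal g₁ I))
      (leadingExponents (oplexOrder n) (actIdeal g₂ J))) d).ncard ≤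
        hilbert (I * actIdeal g J) d := by
  obtain ⟨w₁, hw₁⟩ := exists_reversedByWeight_lexOrder n d
  obtain ⟨w₂, hw₂⟩ := exists_reversedByWeight_oplexOrder n d
  obtain ⟨t, ht⟩ := exists_ncard_add_le_hilbert_mul hw₁ hw₂ (isHomogeneousIdeal_actIdeal g₁ hI)
    (isHomogeneousIdeal_actIdeal g₂ hJ)
  refine ⟨(torus w₁ t * g₁)⁻¹ * (torus w₂ t * g₂), ht.trans_eq ?_⟩
  rw [← hilbert_actIdeal (torus w₁ t * g₁) (I * _), actIdeal_mul, actIdeal_actIdeal,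
    actIdeal_actIdeal, actIdeal_actIdeal, mul_inv_cancel_left]

end Degeneration

end GeneralIntersections

end

/-! ### The main theorem -/

theorem corollary2p6 {K : Type*} [Field K] [Infinite K] {n : ℕ}
    (I J : Ideal (MvPolynomial (Fin n) K))
    (hI : GeneralIntersections.IsHomogeneousIdeal I)
    (hJ : GeneralIntersections.IsHomogeneousIdeal J) :
    GeneralIntersections.ForGeneral fun g : GL (Fin n) K =>
      (∀ d : ℕ,
        GeneralIntersections.hilbert (I ⊓ GeneralIntersections.actIdeal g J) d ≤
          GeneralIntersections.hilbert
            (GeneralIntersections.gin (GeneralIntersections.lexOrder n) I ⊓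
              GeneralIntersections.gin (GeneralIntersections.oplexOrder n) J) d) ∧
      (∀ d : ℕ,
        GeneralIntersections.hilbert
            (GeneralIntersections.gin (GeneralIntersections.lexOrder n) I *
              GeneralIntersections.gin (GeneralIntersections.oplexOrder n) J) d ≤
          GeneralIntersections.hilbert (I * GeneralIntersections.actIdeal g J) d) := by
  obtain ⟨g₁, hg₁⟩ := GeneralIntersections.exists_gin_eq_initialIdeal
    (GeneralIntersections.lexOrder n) hI
  obtain ⟨g₂, hg₂⟩ := GeneralIntersections.exists_gin_eq_initialIdeal
    (GeneralIntersections.oplexOrder n) hJ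
  rw [hg₁, hg₂, GeneralIntersections.initialIdeal_eq_monomialIdeal,
    GeneralIntersections.initialIdeal_eq_monomialIdeal]
  have hE := GeneralIntersections.isUpperSet_leadingExponents
    (GeneralIntersections.lexOrder n) (GeneralIntersections.actIdeal g₁ I)
  have hF := GeneralIntersections.isUpperSet_leadingExponents
    (GeneralIntersections.oplexOrder n) (GeneralIntersections.actIdeal g₂ J)
  rw [GeneralIntersections.monomialIdeal_inf hE hF, GeneralIntersections.monomialIdeal_mul]
  refine ((GeneralIntersections.forGeneral_hilbert_sup_actIdeal_le hI hJ).and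
    (GeneralIntersections.forGeneral_hilbert_mul_actIdeal_le hI hJ)).mono
    fun g hg => ⟨fun d => ?_, fun d => ?_⟩
  · obtain ⟨h, hh⟩ := GeneralIntersections.exists_ncard_union_le_hilbert_sup_actIdeal hI hJ g₁ g₂ d
    have hsup := hh.trans (hg.1 h d)
    have hdim := GeneralIntersections.hilbert_inf_add_hilbert_sup_le hI
      (GeneralIntersections.isHomogeneousIdeal_actIdeal g hJ) d
    have hHI := GeneralIntersections.hilbert_eq_ncard (GeneralIntersections.lexOrder n)
      (GeneralIntersections.isHomogeneousIdeal_actIdeal g₁ hI) d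
    have hHJ := GeneralIntersections.hilbert_eq_ncard (GeneralIntersections.oplexOrder n)
      (GeneralIntersections.isHomogeneousIdeal_actIdeal g₂ hJ) d
    rw [GeneralIntersections.hilbert_actIdeal] at hHI hHJ hdim
    rw [GeneralIntersections.hilbert_monomialIdeal (hE.inter hF)]
    have hcard := GeneralIntersections.ncard_degreeSlice_union_add_inter
      (GeneralIntersections.leadingExponents (GeneralIntersections.lexOrder n)
        (GeneralIntersections.actIdeal g₁ I))
      (GeneralIntersections.leadingExponents (GeneralIntersections.oplexOrder n)
        (GeneralIntersections.actIdeal g₂ J)) d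
    -- The dimension formula for `I` and `g(J)` is compared with inclusion–exclusion for the
    -- exponent sets. The totals agree and the sum of ideals is at least the union, so the
    -- intersection of ideals is at most that of the exponent sets.
    omega
  · obtain ⟨h, hh⟩ := GeneralIntersections.exists_ncard_add_le_hilbert_mul_actIdeal hI hJ g₁ g₂ d
    rw [GeneralIntersections.hilbert_monomialIdeal
      (GeneralIntersections.isUpperSet_image2_add hE)]
    exact hh.trans (hg.2 h d)
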